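/- Let $X$ be a real Banach space. Call a function $q:X\to\mathbb R$ a continuous quadratic form if there is a continuous bilinear form $b:X\times X\to\mathbb R$ with $q(x)=b(x,x)$ for all $x\in X$. Call a bounded operator $T:X\to\ell_2$ $2$-summing if there is a constant $C$ such that $$\Big(\sum_{i=1}^n\|Tx_i\|^2\Big)^{1/2}\le C\,\sup\Big\{\Big(\sum_{i=1}^n|\xi(x_i)|^2\Big)^{1/2} : \xi\in X^*,\ \|\xi\|\le 1\Big\}$$ for all finite families $x_1,\dots,x_n$ in $X$. Then the following conditions are equivalent: (i) $X$ is a Hilbert–Schmidt space, that is, every bounded operator $T:X\to\ell_2$ is $2$-summing. (ii) For every real Banach space $Y$ containing $X$ isometrically as a subspace, every nonnegative continuous quadratic form $q$ on $X$ (that is, $q(x)\ge 0$ for all $x\in X$) extends to a continuous quadratic form $Q$ on $Y$, i.e. $Q|_X=q$. -/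

import Mathlib

universe u v

noncomputable section

/-- A bounded operator `T : X → Y` between real Banach spaces is `p`-summing (`0 < p < ∞`) if there
is a constant `C` such that, for all finite families `x₁, …, xₙ` in `X`,
`(∑ ‖T xᵢ‖ ^ p) ^ (1 / p) ≤ C * sup {(∑ |ξ xᵢ| ^ p) ^ (1 / p) : ξ ∈ B(X*)}`.
The supremum is over the closed unit ball of the dual; it is a supremum of a nonempty set of reals
bounded above, because `|ξ xᵢ| ≤ ‖xᵢ‖`. -/
def IsPSumming {X Y : Type*} [NormedAddCommGroup X] [NormedSpace ℝ X]
    [NormedAddCommGroup Y] [NormedSpace ℝ Y] (p : ℝ) (T : X →L[ℝ] Y) : Prop :=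
  ∃ C : ℝ, ∀ (n : ℕ) (x : Fin n → X),
    (∑ i, ‖T (x i)‖ ^ p) ^ (1 / p) ≤
      C * ⨆ ξ : Metric.closedBall (0 : StrongDual ℝ X) 1,
        (∑ i, |(ξ : StrongDual ℝ X) (x i)| ^ p) ^ (1 / p)

/-- The real Hilbert space `ℓ₂` of square-summable sequences. -/
abbrev EllTwo : Type := lp (fun _ : ℕ => ℝ) 2

/-- `X` is a Hilbert–Schmidt space: every bounded operator `X → ℓ₂` is `2`-summing. -/
def IsHilbertSchmidtSpace (X : Type*) [NormedAddCommGroup X] [NormedSpace ℝ X] : Prop :=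
  ∀ T : X →L[ℝ] EllTwo, IsPSumming 2 T

/-- `q : X → ℝ` is a continuous quadratic form: there is a continuous bilinear form `b` on `X`
such that `q x = b x x` for each `x`. -/
def IsContinuousQuadraticForm {X : Type*} [NormedAddCommGroup X] [NormedSpace ℝ X]
    (q : X → ℝ) : Prop :=
  ∃ b : X →L[ℝ] X →L[ℝ] ℝ, ∀ x, q x = b x x

end

/-! Both directions pass through $\ell_\infty(B_{X^*})$, into which $X$ embeds by evaluation $J$.

(i) ⇒ (ii): a nonnegative form is $q=\|T\cdot\|^2$ with $T$ into a Hilbert space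
(`IsContinuousQuadraticForm.exists_hilbert`), and $T$ obeys a 2-summing bound
(`IsHilbertSchmidtSpace.exists_weakSquareBound`). Pietsch domination
(`exists_mean_of_weakSquareBound`) gives a positive functional $m$ with $q(x)\le m((Jx)^2)$.
Extending each functional by Hahn–Banach extends $J$ to $Y$, so a nonnegative form on $Y$ dominates
$q$. Then $T$ factors through the Hilbert space of that form, and an orthogonal projection extends
$q$ itself (`IsContinuousQuadraticForm.exists_extension_of_le`).

(ii) ⇒ (i): extend $\|T\cdot\|^2$ to a form on $\ell_\infty(B_{X^*})$. Grothendieck's inequality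
(`sum_bilin_le_of_sum_sq_le`) bounds its sums by the supremum of $\sum f_i^2$, which is the
2-summing estimate. The inequality is proved by truncating Rademacher sums: the remainders cost half
the current constant, so iteration removes that constant. -/

/-! ### Moments of Rademacher sums. -/

section SignSums

/-- The signed sum `∑ i, ± f i`, with the sign `+` exactly at the indices where `ε` is true. -/
def signSum {V : Type*} [AddCommGroup V] {n : ℕ} (f : Fin n → V) (ε : Fin n → Bool) : V :=
  ∑ i, if ε i then f i else -f i

variable {V : Type*} [AddCommGroup V] {n : ℕ}

lemma signSum_cons_true (f : Fin (n + 1) → V) (ε : Fin n → Bool) :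
    signSum f (Fin.cons true ε) = f 0 + signSum (fun i => f i.succ) ε := by
  simp [signSum, Fin.sum_univ_succ]

lemma signSum_cons_false (f : Fin (n + 1) → V) (ε : Fin n → Bool) :
    signSum f (Fin.cons false ε) = -f 0 + signSum (fun i => f i.succ) ε := by
  simp [signSum, Fin.sum_univ_succ]

lemma signSum_apply {S : Type*} (f : Fin n → S → ℝ) (ε : Fin n → Bool) (s : S) :
    signSum f ε s = signSum (fun i => f i s) ε := by
  simp only [signSum, Finset.sum_apply]
  refine Finset.sum_congr rfl fun i _ => ?_
  split_ifs <;> simp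

lemma sum_fin_succ_bool (Φ : (Fin (n + 1) → Bool) → ℝ) :
    ∑ ε, Φ ε = ∑ ε : Fin n → Bool, (Φ (Fin.cons true ε) + Φ (Fin.cons false ε)) := by
  rw [← (Fin.consEquiv fun _ => Bool).sum_comp, Fintype.sum_prod_type, Finset.sum_add_distrib]
  simp [Fin.consEquiv]

/-- Independent signs are orthogonal, so the cross terms cancel on averaging. -/
lemma sum_signSum_bilin [Module ℝ V] (B : V →ₗ[ℝ] V →ₗ[ℝ] ℝ) (f g : Fin n → V) :
    ∑ ε, B (signSum f ε) (signSum g ε) = 2 ^ n * ∑ i, B (f i) (g i) := by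
  induction n with
  | zero => simp [signSum]
  | succ n ih =>
    rw [sum_fin_succ_bool, Fin.sum_univ_succ]
    have h : ∀ ε : Fin n → Bool,
        B (signSum f (Fin.cons true ε)) (signSum g (Fin.cons true ε)) +
          B (signSum f (Fin.cons false ε)) (signSum g (Fin.cons false ε)) =
        2 * B (f 0) (g 0) +
          2 * B (signSum (fun i => f i.succ) ε) (signSum (fun i => g i.succ) ε) := by
      intro ε
      simp only [signSum_cons_true, signSum_cons_false, map_add, map_neg, LinearMap.add_apply,
        LinearMap.neg_apply]
      ring
    simp only [h, Finset.sum_add_distrib, ← Finset.mul_sum, ih]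
    simp
    ring

lemma sum_signSum_sq (a : Fin n → ℝ) :
    ∑ ε, signSum a ε ^ 2 = 2 ^ n * ∑ i, a i ^ 2 := by
  simpa [sq] using sum_signSum_bilin (LinearMap.mul ℝ ℝ) a a

/-- Khintchine's inequality for the fourth moment. -/
lemma sum_signSum_pow_four_le (a : Fin n → ℝ) :
    ∑ ε, signSum a ε ^ 4 ≤ 2 ^ n * (3 * (∑ i, a i ^ 2) ^ 2) := by
  induction n with
  | zero => simp [signSum]
  | succ n ih =>
    rw [sum_fin_succ_bool, Fin.sum_univ_succ]
    have h : ∀ ε : Fin n → Bool,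
        signSum a (Fin.cons true ε) ^ 4 + signSum a (Fin.cons false ε) ^ 4 =
          2 * a 0 ^ 4 + 12 * a 0 ^ 2 * signSum (fun i => a i.succ) ε ^ 2 +
            2 * signSum (fun i => a i.succ) ε ^ 4 := by
      intro ε
      simp only [signSum_cons_true, signSum_cons_false]
      ring
    simp only [h, Finset.sum_add_distrib, ← Finset.mul_sum, sum_signSum_sq]
    have := ih fun i => a i.succ
    simp only [Finset.sum_const, Finset.card_univ, Fintype.card_fun, Fintype.card_bool,
      Fintype.card_fin, nsmul_eq_mul, Nat.cast_pow, Nat.cast_ofNat]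
    have h4 : 0 ≤ (2 : ℝ) ^ n * a 0 ^ 4 := by positivity
    rw [pow_succ (2 : ℝ) n]
    linarith

end SignSums

/-! ### Grothendieck's inequality on a finite set. -/

section FiniteGrothendieck

lemma abs_clamp_le {M : ℝ} (hM : 0 ≤ M) (t : ℝ) : |max (-M) (min M t)| ≤ M := by
  rw [abs_le]
  exact ⟨le_max_left _ _, max_le (by linarith) (min_le_left _ _)⟩

lemma clamp_sq_le {M : ℝ} (hM : 0 ≤ M) (t : ℝ) : max (-M) (min M t) ^ 2 ≤ t ^ 2 := by
  rw [sq_le_sq]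
  rcases le_total M t with h | h <;> rcases le_total (-M) t with h' | h'
  · rw [min_eq_left h, max_eq_right (by linarith), abs_of_nonneg hM]
    exact h.trans (le_abs_self t)
  · rw [min_eq_left h, max_eq_right (by linarith), abs_of_nonneg hM]
    exact h.trans (le_abs_self t)
  · rw [min_eq_right h, max_eq_right h']
  · rw [min_eq_right h, max_eq_left h', abs_neg, abs_of_nonneg hM]
    exact le_trans (by linarith) (neg_le_abs t)

/-- The remainder vanishes unless $|t|>M$, where $M(|t|-M)\le t^2$. This lets the fourth moment
control the truncation error. -/
lemma sq_mul_sub_clamp_sq_le {M : ℝ} (hM : 0 ≤ M) (t : ℝ) :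
    M ^ 2 * (t - max (-M) (min M t)) ^ 2 ≤ t ^ 4 := by
  have key : ∀ u : ℝ, M ≤ u → M ^ 2 * (u - M) ^ 2 ≤ u ^ 4 := by
    intro u hu
    have h1 : M * (u - M) ≤ u ^ 2 := by nlinarith
    have h0 : 0 ≤ M * (u - M) := mul_nonneg hM (by linarith)
    calc M ^ 2 * (u - M) ^ 2 = (M * (u - M)) ^ 2 := by ring
      _ ≤ (u ^ 2) ^ 2 := by gcongr
      _ = u ^ 4 := by ring
  rcases le_total M t with h | h
  · rw [min_eq_left h, max_eq_right (by linarith)]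
    exact key t h
  · rcases le_total (-M) t with h' | h'
    · rw [min_eq_right h, max_eq_right h', sub_self, zero_pow two_ne_zero, mul_zero]
      positivity
    · rw [min_eq_right h, max_eq_left h']
      have := key (-t) (by linarith)
      calc M ^ 2 * (t - -M) ^ 2 = M ^ 2 * (-t - M) ^ 2 := by ring
        _ ≤ (-t) ^ 4 := this
        _ = t ^ 4 := by ring

variable {S : Type*}

/-- `c` bounds `∑ i, B (f i) (g i)` over all finite families of functions on `S` whose square
functions are at most `1`. -/
def HilbertianBound (B : (S → ℝ) →ₗ[ℝ] (S → ℝ) →ₗ[ℝ] ℝ) (c : ℝ) : Prop :=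
  ∀ (ι : Type) [Fintype ι] (f g : ι → S → ℝ), (∀ s, ∑ i, f i s ^ 2 ≤ 1) →
    (∀ s, ∑ i, g i s ^ 2 ≤ 1) → ∑ i, B (f i) (g i) ≤ c

/-- Truncation at height `8` of the signed sums improves a bound. -/
lemma HilbertianBound.improve {B : (S → ℝ) →ₗ[ℝ] (S → ℝ) →ₗ[ℝ] ℝ} {C c : ℝ}
    (hB : ∀ f g : S → ℝ, (∀ s, |f s| ≤ 8) → (∀ s, |g s| ≤ 8) → B f g ≤ C)
    (h : HilbertianBound B c) : HilbertianBound B (C + c / 2) := by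
  intro ι _ f₀ g₀ hf₀ hg₀
  set n := Fintype.card ι
  let e : Fin n ≃ ι := (Fintype.equivFin ι).symm
  set f : Fin n → S → ℝ := fun i => f₀ (e i) with hfdef
  set g : Fin n → S → ℝ := fun i => g₀ (e i) with hgdef
  have hf : ∀ s, ∑ i, f i s ^ 2 ≤ 1 := fun s => by
    rw [hfdef, e.sum_comp (fun i => f₀ i s ^ 2)]; exact hf₀ s
  have hg : ∀ s, ∑ i, g i s ^ 2 ≤ 1 := fun s => by
    rw [hgdef, e.sum_comp (fun i => g₀ i s ^ 2)]; exact hg₀ s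
  rw [← e.sum_comp (fun i => B (f₀ i) (g₀ i))]
  change ∑ i, B (f i) (g i) ≤ _
  let tr : (Fin n → S → ℝ) → (Fin n → Bool) → S → ℝ :=
    fun f ε s => max (-8) (min 8 (signSum f ε s))
  let re : (Fin n → S → ℝ) → (Fin n → Bool) → S → ℝ := fun f ε => signSum f ε - tr f ε
  set a : ℝ := (√(2 ^ n))⁻¹ with ha
  have ha2 : a ^ 2 * 2 ^ n = 1 := by
    rw [ha, inv_pow, Real.sq_sqrt (by positivity)]
    exact inv_mul_cancel₀ (by positivity)
  have bF : ∀ f : Fin n → S → ℝ, (∀ s, ∑ i, f i s ^ 2 ≤ 1) →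
      ∀ s, ∑ ε, (a • signSum f ε) s ^ 2 ≤ 1 := by
    intro f hf s
    simp only [Pi.smul_apply, smul_eq_mul, mul_pow, ← Finset.mul_sum, signSum_apply,
      sum_signSum_sq]
    rw [← mul_assoc, ha2, one_mul]
    exact hf s
  have bG : ∀ f : Fin n → S → ℝ, (∀ s, ∑ i, f i s ^ 2 ≤ 1) →
      ∀ s, ∑ ε, (a • tr f ε) s ^ 2 ≤ 1 := by
    intro f hf s
    refine le_trans (Finset.sum_le_sum fun ε _ => ?_) (bF f hf s)
    simp only [Pi.smul_apply, smul_eq_mul, mul_pow]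
    exact mul_le_mul_of_nonneg_left (clamp_sq_le (by norm_num) _) (sq_nonneg a)
  -- The mean square of the remainder is at most $3/8^2\le 1/4^2$, so it may be scaled up by 4. Each
  -- of the two error terms then costs $c/4$.
  have bR : ∀ f : Fin n → S → ℝ, (∀ s, ∑ i, f i s ^ 2 ≤ 1) →
      ∀ s, ∑ ε, ((4 * a) • re f ε) s ^ 2 ≤ 1 := by
    intro f hf s
    have h1 : ∀ ε, ((4 * a) • re f ε) s ^ 2 ≤ a ^ 2 / 4 * signSum (fun i => f i s) ε ^ 4 := by
      intro ε
      have := sq_mul_sub_clamp_sq_le (M := 8) (by norm_num) (signSum f ε s)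
      have h2 := mul_le_mul_of_nonneg_left this (sq_nonneg a)
      simp only [re, tr, Pi.smul_apply, Pi.sub_apply, smul_eq_mul, mul_pow] at *
      rw [← signSum_apply]
      linarith
    refine (Finset.sum_le_sum fun ε _ => h1 ε).trans ?_
    rw [← Finset.mul_sum]
    have h3 := sum_signSum_pow_four_le fun i => f i s
    have h4 : (∑ i, f i s ^ 2) ^ 2 ≤ 1 := pow_le_one₀ (by positivity) (hf s)
    calc a ^ 2 / 4 * ∑ ε, signSum (fun i => f i s) ε ^ 4
        ≤ a ^ 2 / 4 * (2 ^ n * (3 * (∑ i, f i s ^ 2) ^ 2)) := by gcongr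
      _ = (a ^ 2 * 2 ^ n) * (3 / 4 * (∑ i, f i s ^ 2) ^ 2) := by ring
      _ ≤ 1 := by rw [ha2]; linarith
  have e1 := h _ _ _ (bR f hf) (bF g hg)
  have e2 := h _ _ _ (bG f hf) (bR g hg)
  have e3 : ∑ ε, B (tr f ε) (tr g ε) ≤ 2 ^ n * C := by
    refine (Finset.sum_le_sum fun ε _ => hB (tr f ε) (tr g ε)
      (fun s => abs_clamp_le (by norm_num) _) fun s => abs_clamp_le (by norm_num) _).trans ?_
    simp
  have key : 2 ^ n * ∑ i, B (f i) (g i) =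
      ∑ ε, B (tr f ε) (tr g ε) + ∑ ε, B (re f ε) (signSum g ε) + ∑ ε, B (tr f ε) (re g ε) := by
    rw [← sum_signSum_bilin, ← Finset.sum_add_distrib, ← Finset.sum_add_distrib]
    refine Finset.sum_congr rfl fun ε _ => ?_
    simp only [re, map_sub, LinearMap.sub_apply]
    ring
  simp only [map_smul, LinearMap.smul_apply, smul_eq_mul, ← Finset.mul_sum] at e1 e2
  have key2 : ∑ i, B (f i) (g i) = a ^ 2 * (2 ^ n * ∑ i, B (f i) (g i)) := by
    rw [← mul_assoc, ha2, one_mul]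
  have e4 := mul_le_mul_of_nonneg_left e3 (sq_nonneg a)
  rw [← mul_assoc, ha2, one_mul] at e4
  rw [key2, key]
  linarith

variable [Fintype S]

/-- Some finite constant is needed to start the iteration; the sum of the absolute matrix entries
serves, by Cauchy–Schwarz. -/
lemma exists_hilbertianBound (B : (S → ℝ) →ₗ[ℝ] (S → ℝ) →ₗ[ℝ] ℝ) :
    ∃ c, HilbertianBound B c := by
  classical
  refine ⟨∑ s, ∑ t, |B (Pi.single s 1) (Pi.single t 1)|, fun ι _ f g hf hg => ?_⟩
  have hexp : ∀ φ ψ : S → ℝ,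
      B φ ψ = ∑ s, ∑ t, φ s * ψ t * B (Pi.single s 1) (Pi.single t 1) := by
    intro φ ψ
    conv_lhs => rw [pi_eq_sum_univ' φ, pi_eq_sum_univ' ψ]
    simp only [map_sum, LinearMap.sum_apply, map_smul, LinearMap.smul_apply, smul_eq_mul,
      Finset.mul_sum]
    rw [Finset.sum_comm]
    refine Finset.sum_congr rfl fun s _ => Finset.sum_congr rfl fun t _ => ?_
    ring
  simp only [hexp (f _)]
  rw [Finset.sum_comm]
  refine Finset.sum_le_sum fun s _ => ?_
  rw [Finset.sum_comm]
  refine Finset.sum_le_sum fun t _ => ?_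
  rw [← Finset.sum_mul]
  refine (le_abs_self _).trans ?_
  rw [abs_mul]
  refine mul_le_of_le_one_left (abs_nonneg _) ?_
  rw [← sq_le_one_iff_abs_le_one]
  refine (Finset.sum_mul_sq_le_sq_mul_sq _ _ _).trans ?_
  exact mul_le_one₀ (hf s) (by positivity) (hg t)

/-- Grothendieck's inequality for bilinear forms on functions on a finite set. -/
theorem hilbertianBound_of_bounded (B : (S → ℝ) →ₗ[ℝ] (S → ℝ) →ₗ[ℝ] ℝ) {C : ℝ}
    (hB : ∀ f g : S → ℝ, (∀ s, |f s| ≤ 8) → (∀ s, |g s| ≤ 8) → B f g ≤ C) :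
    HilbertianBound B (2 * C) := by
  obtain ⟨c, hc⟩ := exists_hilbertianBound B
  -- $2C$ is the fixed point of $c\mapsto C+c/2$.
  have hk : ∀ k : ℕ, HilbertianBound B (2 * C + (1 / 2) ^ k * (c - 2 * C)) := by
    intro k
    induction k with
    | zero => simpa using hc
    | succ k ih =>
      convert ih.improve hB using 1
      ring
  intro ι _ f g hf hg
  have hlim : Filter.Tendsto (fun k : ℕ => 2 * C + (1 / 2 : ℝ) ^ k * (c - 2 * C)) Filter.atTop
      (nhds (2 * C + 0 * (c - 2 * C))) :=
    ((tendsto_pow_atTop_nhds_zero_of_lt_one (by norm_num) (by norm_num)).mul_const _).const_add _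
  rw [zero_mul, add_zero] at hlim
  exact ge_of_tendsto' hlim fun k => hk k ι f g hf hg

end FiniteGrothendieck

/-! ### Grothendieck's inequality on $\ell_\infty(S)$. -/

section BoundedFunctions

/-- The Banach space `ℓ∞(S)` of bounded real functions on `S`. -/
abbrev EllInfty (S : Type*) : Type _ := lp (fun _ : S => ℝ) ⊤

variable {S : Type*}

/-- A bounded function as an element of `ℓ∞(S)`. -/
def EllInfty.mk (φ : S → ℝ) (C : ℝ) (h : ∀ s, |φ s| ≤ C) : EllInfty S :=
  ⟨φ, memℓp_infty ⟨C, by rintro _ ⟨s, rfl⟩; exact h s⟩⟩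

lemma EllInfty.abs_apply_le (f : EllInfty S) (s : S) : |f s| ≤ ‖f‖ :=
  lp.norm_apply_le_norm ENNReal.top_ne_zero f s

lemma EllInfty.norm_le {f : EllInfty S} {C : ℝ} (hC : 0 ≤ C) (h : ∀ s, |f s| ≤ C) : ‖f‖ ≤ C :=
  lp.norm_le_of_forall_le hC h

/-- Grothendieck's inequality for bilinear forms on `ℓ∞(S)`. -/
theorem sum_bilin_le_of_sum_sq_le_one (B : EllInfty S →L[ℝ] EllInfty S →L[ℝ] ℝ) {ι : Type}
    [Fintype ι] (f : ι → EllInfty S) (hf : ∀ s, ∑ i, f i s ^ 2 ≤ 1) :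
    ∑ i, B (f i) (f i) ≤ 128 * ‖B‖ := by
  have hclosed : IsClosed {g : ι → EllInfty S | ∑ i, B (g i) (g i) ≤ 128 * ‖B‖} :=
    isClosed_le (by fun_prop) continuous_const
  refine hclosed.closure_subset (Metric.mem_closure_iff.2 fun δ hδ => ?_)
  let F : S → ι → ℝ := fun s i => f i s
  have hbdd : Bornology.IsBounded (Set.range F) := by
    refine (Metric.isBounded_closedBall (x := (0 : ι → ℝ)) (r := 1)).subset ?_
    rintro _ ⟨s, rfl⟩
    rw [mem_closedBall_zero_iff, pi_norm_le_iff_of_nonneg zero_le_one]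
    intro i
    rw [Real.norm_eq_abs, ← sq_le_one_iff_abs_le_one]
    exact (Finset.single_le_sum (f := fun i => f i s ^ 2) (fun _ _ => sq_nonneg _)
      (Finset.mem_univ i)).trans (hf s)
  -- The net is chosen inside the range of `F`, so the bound on the sum of squares holds exactly at
  -- its points.
  obtain ⟨t, hts, htfin, hcov⟩ := Metric.finite_approx_of_totallyBounded
    (((Metric.isCompact_of_isClosed_isBounded isClosed_closure hbdd.closure).totallyBounded).subset
      subset_closure) (δ / 2) (half_pos hδ)
  have : Fintype t := htfin.fintype
  have hr : ∀ s, ∃ y : t, dist (F s) y < δ / 2 := by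
    intro s
    obtain ⟨y, hy, hd⟩ := Set.mem_iUnion₂.1 (hcov ⟨s, rfl⟩)
    exact ⟨⟨y, hy⟩, hd⟩
  choose r hr using hr
  let E : (t → ℝ) →ₗ[ℝ] EllInfty S :=
    { toFun := fun φ => EllInfty.mk
        (fun s => φ (r s)) ‖φ‖ fun s => norm_le_pi_norm φ (r s)
      map_add' := fun φ ψ => by ext; rfl
      map_smul' := fun a φ => by ext; rfl }
  have hE : ∀ φ : t → ℝ, (∀ y, |φ y| ≤ 8) → ‖E φ‖ ≤ 8 := fun φ hφ =>
    EllInfty.norm_le (by norm_num) fun s => hφ (r s)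
  let B' : (t → ℝ) →ₗ[ℝ] (t → ℝ) →ₗ[ℝ] ℝ := LinearMap.mk₂ ℝ (fun φ ψ => B (E φ) (E ψ))
    (by simp) (by simp) (by simp) (by simp)
  have hB' : ∀ φ ψ : t → ℝ, (∀ y, |φ y| ≤ 8) → (∀ y, |ψ y| ≤ 8) → B' φ ψ ≤ 64 * ‖B‖ := by
    intro φ ψ hφ hψ
    calc B (E φ) (E ψ) ≤ ‖B (E φ) (E ψ)‖ := le_abs_self _
      _ ≤ ‖B‖ * ‖E φ‖ * ‖E ψ‖ := B.le_opNorm₂ _ _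
      _ ≤ ‖B‖ * 8 * 8 := by
        gcongr
        exacts [hE φ hφ, hE ψ hψ]
      _ = 64 * ‖B‖ := by ring
  let φ : ι → t → ℝ := fun i y => (y : ι → ℝ) i
  have hφ : ∀ y, ∑ i, φ i y ^ 2 ≤ 1 := by
    rintro ⟨y, hy⟩
    obtain ⟨s, rfl⟩ := hts hy
    exact hf s
  refine ⟨fun i => E (φ i), ?_, ?_⟩
  · have := hilbertianBound_of_bounded B' hB' ι φ φ hφ hφ
    simp only [Set.mem_ofPred_eq]
    calc ∑ i, B (E (φ i)) (E (φ i)) ≤ 2 * (64 * ‖B‖) := this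
      _ = 128 * ‖B‖ := by ring
  · refine lt_of_le_of_lt ?_ (half_lt_self hδ)
    rw [dist_pi_le_iff (half_pos hδ).le]
    intro i
    rw [dist_eq_norm]
    refine EllInfty.norm_le (half_pos hδ).le fun s => ?_
    exact (dist_le_pi_dist (F s) (r s : ι → ℝ) i).trans (hr s).le

theorem sum_bilin_le_of_sum_sq_le (B : EllInfty S →L[ℝ] EllInfty S →L[ℝ] ℝ) {ι : Type}
    [Fintype ι] (f : ι → EllInfty S) {M : ℝ} (hM : 0 ≤ M) (hf : ∀ s, ∑ i, f i s ^ 2 ≤ M) :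
    ∑ i, B (f i) (f i) ≤ 128 * ‖B‖ * M := by
  -- `M` may be zero, so the family is normalised by `M + δ`.
  have hpos : ∀ δ > 0, ∑ i, B (f i) (f i) ≤ 128 * ‖B‖ * (M + δ) := by
    intro δ hδ
    have hMδ : 0 < M + δ := by linarith
    have ha : (√(M + δ))⁻¹ ^ 2 = (M + δ)⁻¹ := by rw [inv_pow, Real.sq_sqrt hMδ.le]
    have := sum_bilin_le_of_sum_sq_le_one B (fun i => (√(M + δ))⁻¹ • f i) fun s => by
      simp only [lp.coeFn_smul, Pi.smul_apply, smul_eq_mul, mul_pow, ha, ← Finset.mul_sum]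
      rw [inv_mul_le_one₀ hMδ]
      linarith [hf s]
    simp only [map_smul, smul_apply, smul_eq_mul, ← Finset.mul_sum,
      ← mul_assoc, ← sq, ha] at this
    rwa [inv_mul_le_iff₀ hMδ, mul_comm] at this
  have hlim : Filter.Tendsto (fun δ : ℝ => 128 * ‖B‖ * (M + δ)) (nhdsWithin 0 (Set.Ioi 0))
      (nhds (128 * ‖B‖ * (M + 0))) :=
    ((by fun_prop : Continuous fun δ : ℝ => 128 * ‖B‖ * (M + δ)).tendsto 0).mono_left
      nhdsWithin_le_nhds
  rw [add_zero] at hlim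
  exact ge_of_tendsto hlim (Filter.eventually_of_mem self_mem_nhdsWithin hpos)

end BoundedFunctions

/-! ### 2-summing operators without roots or suprema. -/

section TwoSumming

/-- `C` bounds the sums `∑ q (x i)` over finite families which are weakly square-summable with
constant at most `1`, in a homogeneous form. -/
def WeakSquareBound {X : Type*} [NormedAddCommGroup X] [NormedSpace ℝ X] (q : X → ℝ)
    (C : ℝ) : Prop :=
  ∀ (n : ℕ) (x : Fin n → X) (M : ℝ), 0 ≤ M →
    (∀ ξ : StrongDual ℝ X, ‖ξ‖ ≤ 1 → ∑ i, ξ (x i) ^ 2 ≤ M) → ∑ i, q (x i) ≤ C * M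

theorem isPSumming_two_iff {X Y : Type*} [NormedAddCommGroup X] [NormedSpace ℝ X]
    [NormedAddCommGroup Y] [NormedSpace ℝ Y] (T : X →L[ℝ] Y) :
    IsPSumming 2 T ↔ ∃ C, 0 ≤ C ∧ WeakSquareBound (fun x => ‖T x‖ ^ 2) C := by
  have hterm : ∀ (n : ℕ) (x : Fin n → X) (ξ : StrongDual ℝ X),
      (∑ i, |ξ (x i)| ^ (2 : ℝ)) ^ (1 / 2 : ℝ) = √(∑ i, ξ (x i) ^ 2) := by
    intro n x ξ
    simp [Real.sqrt_eq_rpow]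
  have hlhs : ∀ (n : ℕ) (x : Fin n → X),
      (∑ i, ‖T (x i)‖ ^ (2 : ℝ)) ^ (1 / 2 : ℝ) = √(∑ i, ‖T (x i)‖ ^ 2) := by
    intro n x
    simp [Real.sqrt_eq_rpow]
  simp only [IsPSumming, hterm, hlhs]
  constructor
  · rintro ⟨C, hC⟩
    refine ⟨C ^ 2, sq_nonneg C, fun n x M hM hx => ?_⟩
    have h1 : (⨆ ξ : Metric.closedBall (0 : StrongDual ℝ X) 1,
        √(∑ i, (ξ : StrongDual ℝ X) (x i) ^ 2)) ≤ √M :=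
      Real.iSup_le (fun ξ => Real.sqrt_le_sqrt (hx ξ (mem_closedBall_zero_iff.1 ξ.2))) (Real.sqrt_nonneg _)
    have h0 : 0 ≤ ⨆ ξ : Metric.closedBall (0 : StrongDual ℝ X) 1,
        √(∑ i, (ξ : StrongDual ℝ X) (x i) ^ 2) := Real.iSup_nonneg fun _ => Real.sqrt_nonneg _
    have h2 : √(∑ i, ‖T (x i)‖ ^ 2) ≤ |C| * √M :=
      (hC n x).trans (mul_le_mul (le_abs_self C) h1 h0 (abs_nonneg C))
    calc ∑ i, ‖T (x i)‖ ^ 2 = √(∑ i, ‖T (x i)‖ ^ 2) ^ 2 := (Real.sq_sqrt (by positivity)).symm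
      _ ≤ (|C| * √M) ^ 2 := by gcongr
      _ = C ^ 2 * M := by rw [mul_pow, sq_abs, Real.sq_sqrt hM]
  · rintro ⟨C, hC0, hC⟩
    refine ⟨√C, fun n x => ?_⟩
    set W := ⨆ ξ : Metric.closedBall (0 : StrongDual ℝ X) 1,
      √(∑ i, (ξ : StrongDual ℝ X) (x i) ^ 2) with hW
    have h0 : 0 ≤ W := Real.iSup_nonneg fun _ => Real.sqrt_nonneg _
    have hbdd : BddAbove (Set.range fun ξ : Metric.closedBall (0 : StrongDual ℝ X) 1 =>
        √(∑ i, (ξ : StrongDual ℝ X) (x i) ^ 2)) := by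
      refine ⟨√(∑ i, ‖x i‖ ^ 2), ?_⟩
      rintro _ ⟨ξ, rfl⟩
      refine Real.sqrt_le_sqrt (Finset.sum_le_sum fun i _ => ?_)
      rw [sq_le_sq, abs_of_nonneg (norm_nonneg (x i))]
      have hξ : ‖(ξ : StrongDual ℝ X)‖ ≤ 1 := mem_closedBall_zero_iff.1 ξ.2
      exact ((ξ : StrongDual ℝ X).le_opNorm (x i)).trans
        (mul_le_of_le_one_left (norm_nonneg _) hξ)
    have h1 := hC n x (W ^ 2) (sq_nonneg W) fun ξ hξ => by
      rw [← Real.sqrt_le_left h0]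
      exact le_ciSup hbdd ⟨ξ, by simpa using hξ⟩
    calc √(∑ i, ‖T (x i)‖ ^ 2) ≤ √(C * W ^ 2) := Real.sqrt_le_sqrt h1
      _ = √C * W := by rw [Real.sqrt_mul hC0, Real.sqrt_sq h0]

end TwoSumming

/-! ### From $\ell_2$ to arbitrary Hilbert spaces. -/

section SeparableHilbert

variable {H : Type*} [NormedAddCommGroup H] [InnerProductSpace ℝ H]

/-- Distinct orthonormal vectors are $\sqrt2$ apart, so no point of a dense sequence is within $1/2$
of two of them. -/
lemma Orthonormal.countable [TopologicalSpace.SeparableSpace H] {ι : Type*} {v : ι → H}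
    (hv : Orthonormal ℝ v) : Countable ι := by
  cases isEmpty_or_nonempty ι
  · infer_instance
  have : Nonempty H := ⟨0⟩
  have hk : ∀ i, ∃ k : ℕ, dist (v i) (TopologicalSpace.denseSeq H k) < 1 / 2 := fun i =>
    (TopologicalSpace.denseRange_denseSeq H).exists_dist_lt (v i) (by norm_num)
  choose k hk using hk
  refine Function.Injective.countable (f := k) fun i j hij => ?_
  by_contra hne
  have h1 : dist (v i) (v j) < 1 := by
    have h2 := hk j
    rw [← hij] at h2
    calc dist (v i) (v j) ≤ _ := dist_triangle_right _ _ (TopologicalSpace.denseSeq H (k i))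
      _ < 1 / 2 + 1 / 2 := add_lt_add (hk i) h2
      _ = 1 := by norm_num
  have h3 : dist (v i) (v j) ^ 2 = 2 := by
    rw [dist_eq_norm, @norm_sub_sq_real, hv.2 hne, hv.1 i, hv.1 j]
    norm_num
  nlinarith [dist_nonneg (x := v i) (y := v j)]

/-- Every separable Hilbert space embeds isometrically into `ℓ₂`. -/
theorem exists_linearIsometry_ellTwo [CompleteSpace H] [TopologicalSpace.SeparableSpace H] :
    Nonempty (H →ₗᵢ[ℝ] EllTwo) := by
  obtain ⟨w, b, -⟩ := exists_hilbertBasis ℝ H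
  have : Countable w := b.orthonormal.countable
  obtain ⟨e, he⟩ := exists_injective_nat w
  let c : HilbertBasis ℕ ℝ EllTwo := HilbertBasis.ofRepr (LinearIsometryEquiv.refl ℝ _)
  exact ⟨(c.orthonormal.comp e he).orthogonalFamily.linearIsometry.comp b.repr.toLinearIsometry⟩

/-- A countable family of vectors of a Hilbert space can be mapped to `ℓ₂` preserving norms. -/
theorem exists_continuousLinearMap_ellTwo [CompleteSpace H] {ι : Type*} [Countable ι]
    (v : ι → H) : ∃ P : H →L[ℝ] EllTwo, ∀ i, ‖P (v i)‖ = ‖v i‖ := by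
  let K : Submodule ℝ H := (Submodule.span ℝ (Set.range v)).topologicalClosure
  have hsep : TopologicalSpace.IsSeparable (K : Set H) :=
    ((Set.countable_range v).isSeparable.span (R := ℝ)).closure
  have : TopologicalSpace.SeparableSpace K := hsep.separableSpace
  have : CompleteSpace K :=
    (Submodule.isClosed_topologicalClosure _).completeSpace_coe
  obtain ⟨J⟩ := exists_linearIsometry_ellTwo (H := K)
  refine ⟨J.toContinuousLinearMap.comp K.orthogonalProjectionOnto, fun i => ?_⟩
  have hi : v i ∈ K :=
    Submodule.le_topologicalClosure _ (Submodule.subset_span (Set.mem_range_self i))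
  have := Submodule.orthogonalProjectionOnto_mem_subspace_eq_self (K := K) ⟨v i, hi⟩
  simp only [ContinuousLinearMap.coe_comp, Function.comp_apply,
    LinearIsometry.coe_toContinuousLinearMap, LinearIsometry.norm_map]
  rw [this]
  rfl

/-- On a Hilbert–Schmidt space, operators into arbitrary Hilbert spaces are `2`-summing. -/
theorem IsHilbertSchmidtSpace.exists_weakSquareBound {X : Type*} [NormedAddCommGroup X]
    [NormedSpace ℝ X] (hX : IsHilbertSchmidtSpace X) [CompleteSpace H] (T : X →L[ℝ] H) :
    ∃ C, 0 ≤ C ∧ WeakSquareBound (fun x => ‖T x‖ ^ 2) C := by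
  -- Failure yields a bad finite family for each constant $N$. All these families together are
  -- countable, so one operator `P` into $\ell_2$ preserves the norms of all their images and
  -- `P.comp T` has no finite constant.
  by_contra hcon
  have h : ∀ N : ℕ, ∃ (n : ℕ) (x : Fin n → X) (M : ℝ), 0 ≤ M ∧
      (∀ ξ : StrongDual ℝ X, ‖ξ‖ ≤ 1 → ∑ i, ξ (x i) ^ 2 ≤ M) ∧
      N * M < ∑ i, ‖T (x i)‖ ^ 2 := by
    intro N
    by_contra! hN
    exact hcon ⟨N, Nat.cast_nonneg N, fun n x M hM hx => hN n x M hM hx⟩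
  choose n x M hM hx hlt using h
  obtain ⟨P, hP⟩ := exists_continuousLinearMap_ellTwo fun p : Σ N, Fin (n N) => T (x p.1 p.2)
  obtain ⟨C, hC0, hC⟩ := (isPSumming_two_iff _).1 (hX (P.comp T))
  obtain ⟨N, hN⟩ := exists_nat_ge C
  have h1 := hC (n N) (x N) (M N) (hM N) (hx N)
  have h2 : ∀ i, ‖P (T (x N i))‖ = ‖T (x N i)‖ := fun i => hP ⟨N, i⟩
  simp only [ContinuousLinearMap.coe_comp, Function.comp_apply, h2] at h1
  have h3 := mul_le_mul_of_nonneg_right hN (hM N)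
  linarith [hlt N]

end SeparableHilbert

/-! ### Nonnegative forms as Hilbert norms, and extension under domination. -/

section GelfandNaimarkSegal

/-- A positive semidefinite bilinear form is induced by a linear map into a Hilbert space. -/
theorem LinearMap.exists_hilbert_of_nonneg {E : Type u} [AddCommGroup E] [Module ℝ E]
    (b : E →ₗ[ℝ] E →ₗ[ℝ] ℝ) (hb : ∀ x, 0 ≤ b x x) :
    ∃ (H : Type u) (_ : NormedAddCommGroup H) (_ : InnerProductSpace ℝ H) (_ : CompleteSpace H)
      (T : E →ₗ[ℝ] H), ∀ x, b x x = ‖T x‖ ^ 2 := by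
  -- `b` need not be symmetric, and symmetrising keeps the diagonal. Null vectors are identified
  -- with zero by the Hausdorff completion below.
  let c : PreInnerProductSpace.Core ℝ E :=
    { inner := fun x y => (b x y + b y x) / 2
      conj_inner_symm := fun x y => by simp [add_comm]
      re_inner_nonneg := fun x => by simpa using hb x
      add_left := fun x y z => by simp; ring
      smul_left := fun x y r => by simp; ring }
  let : SeminormedAddCommGroup E := InnerProductSpace.Core.toSeminormedAddCommGroup (c := c)
  let : InnerProductSpace ℝ E := InnerProductSpace.ofCore c
  refine ⟨UniformSpace.Completion E, inferInstance, inferInstance, inferInstance,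
    (UniformSpace.Completion.toComplL (𝕜 := ℝ) (E := E)).toLinearMap, fun x => ?_⟩
  have h1 : inner ℝ x x = b x x := by
    change (b x x + b x x) / 2 = b x x
    ring
  rw [← h1, real_inner_self_eq_norm_sq]
  simp

/-- A nonnegative continuous quadratic form is the square of the norm of an operator into a
Hilbert space. -/
theorem IsContinuousQuadraticForm.exists_hilbert {X : Type u} [NormedAddCommGroup X]
    [NormedSpace ℝ X] {q : X → ℝ} (hq : IsContinuousQuadraticForm q) (hpos : ∀ x, 0 ≤ q x) :
    ∃ (H : Type u) (_ : NormedAddCommGroup H) (_ : InnerProductSpace ℝ H) (_ : CompleteSpace H)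
      (T : X →L[ℝ] H), ∀ x, q x = ‖T x‖ ^ 2 := by
  obtain ⟨b, hb⟩ := hq
  obtain ⟨H, _, _, _, T, hT⟩ := LinearMap.exists_hilbert_of_nonneg b.toLinearMap₁₂
    fun x => (hpos x).trans_eq (hb x)
  have hT' : ∀ x, q x = ‖T x‖ ^ 2 := fun x => (hb x).trans (hT x)
  refine ⟨H, inferInstance, inferInstance, inferInstance, T.mkContinuous (√‖b‖) fun x => ?_, hT'⟩
  refine le_of_sq_le_sq ?_ (by positivity)
  rw [← hT', mul_pow, Real.sq_sqrt (norm_nonneg b), hb]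
  calc b x x ≤ ‖b x x‖ := le_abs_self _
    _ ≤ ‖b‖ * ‖x‖ * ‖x‖ := b.le_opNorm₂ x x
    _ = ‖b‖ * ‖x‖ ^ 2 := by ring

lemma isContinuousQuadraticForm_norm_sq {X H : Type*} [NormedAddCommGroup X] [NormedSpace ℝ X]
    [NormedAddCommGroup H] [InnerProductSpace ℝ H] (T : X →L[ℝ] H) :
    IsContinuousQuadraticForm fun x => ‖T x‖ ^ 2 :=
  ⟨(innerSL ℝ).bilinearComp T T, fun x => by simp⟩

/-- If `q` is dominated by a nonnegative quadratic form of a larger space, then it extends to the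
larger space. -/
theorem IsContinuousQuadraticForm.exists_extension_of_le {X : Type u} [NormedAddCommGroup X]
    [NormedSpace ℝ X] {Y : Type v} [NormedAddCommGroup Y] [NormedSpace ℝ Y] {q : X → ℝ}
    (hq : IsContinuousQuadraticForm q) (hpos : ∀ x, 0 ≤ q x) {p : Y → ℝ}
    (hp : IsContinuousQuadraticForm p) (hp0 : ∀ y, 0 ≤ p y) (j : X →L[ℝ] Y)
    (hle : ∀ x, q x ≤ p (j x)) :
    ∃ Q : Y → ℝ, IsContinuousQuadraticForm Q ∧ ∀ x, Q (j x) = q x := by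
  obtain ⟨H, _, _, _, T, hT⟩ := hq.exists_hilbert hpos
  obtain ⟨G, _, _, _, R, hR⟩ := hp.exists_hilbert hp0
  let L : X →ₗ[ℝ] G := (R.comp j).toLinearMap
  let K : Submodule ℝ G := L.range.topologicalClosure
  have hmem : ∀ x, L x ∈ K := fun x =>
    Submodule.le_topologicalClosure _ (LinearMap.mem_range_self L x)
  let e : X →ₗ[ℝ] K := L.codRestrict K hmem
  have : CompleteSpace K := (Submodule.isClosed_topologicalClosure _).completeSpace_coe
  have hdense : DenseRange e := by
    rintro ⟨y, hy⟩
    have himage : Subtype.val '' Set.range e = (L.range : Set G) := by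
      rw [← Set.range_comp]
      rfl
    rw [closure_subtype, himage]
    exact hy
  have hnorm : ∃ C, ∀ x, ‖T x‖ ≤ C * ‖e x‖ := by
    refine ⟨1, fun x => ?_⟩
    rw [one_mul]
    refine le_of_sq_le_sq ?_ (norm_nonneg _)
    rw [← hT]
    exact (hle x).trans_eq (hR (j x))
  -- By domination, `e x ↦ T x` is a well-defined contraction on a dense subspace of `K`.
  let U : K →L[ℝ] H := T.toLinearMap.extendOfNorm e
  refine ⟨_, isContinuousQuadraticForm_norm_sq
    (U.comp (K.orthogonalProjectionOnto.comp R)), fun x => ?_⟩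
  have h1 : K.orthogonalProjectionOnto (R (j x)) = e x :=
    Submodule.orthogonalProjectionOnto_mem_subspace_eq_self (K := K) ⟨L x, hmem x⟩
  simp only [ContinuousLinearMap.coe_comp, Function.comp_apply, h1]
  rw [hT x]
  congr 2
  exact LinearMap.extendOfNorm_eq hdense hnorm x

end GelfandNaimarkSegal

/-! ### Pietsch domination by Hahn–Banach separation. -/

section PietschDomination

/-- **Pietsch domination**, with a finitely additive mean in place of a probability measure. -/
theorem exists_mean_of_weakSquareBound {X S : Type*} [AddCommGroup X] [Module ℝ X] [Nonempty S]
    (J : X →ₗ[ℝ] EllInfty S) {q : X → ℝ} (hq : ∀ (t : ℝ) x, q (t • x) = t ^ 2 * q x) {C : ℝ}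
    (hC : 0 < C) (hbound : ∀ (n : ℕ) (x : Fin n → X) (M : ℝ), 0 ≤ M →
      (∀ s, ∑ i, J (x i) s ^ 2 ≤ M) → ∑ i, q (x i) ≤ C * M) :
    ∃ m : EllInfty S →L[ℝ] ℝ, (∀ φ : EllInfty S, (∀ s, 0 ≤ φ s) → 0 ≤ m φ) ∧
      ∀ x, q x ≤ m (J x * J x) := by
  let a : X → EllInfty S := fun x => C • (J x * J x) - q x • 1
  have ha_apply : ∀ x s, a x s = C * J x s ^ 2 - q x := fun x s => by
    change C * (J x s * J x s) - q x * 1 = _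
    ring
  have ha_smul : ∀ (t : ℝ) x, a (t • x) = t ^ 2 • a x := fun t x => by
    ext s
    rw [lp.coeFn_smul, Pi.smul_apply, ha_apply, ha_apply, hq, map_smul, lp.coeFn_smul,
      Pi.smul_apply, smul_eq_mul, smul_eq_mul]
    ring
  -- `A` is a convex cone because `q` is 2-homogeneous. The summing bound says exactly that no
  -- member of it is uniformly negative, and a functional separating it from such functions is the
  -- mean, up to scale.
  let A : Set (EllInfty S) := {ψ | ∃ (n : ℕ) (x : Fin n → X), ψ = ∑ i, a (x i)}
  have hA_smul : ∀ t : ℝ, 0 ≤ t → ∀ ψ ∈ A, t • ψ ∈ A := by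
    rintro t ht _ ⟨n, x, rfl⟩
    refine ⟨n, fun i => √t • x i, ?_⟩
    simp only [ha_smul, Real.sq_sqrt ht, Finset.smul_sum]
  have hA_add : ∀ ψ ∈ A, ∀ χ ∈ A, ψ + χ ∈ A := by
    rintro _ ⟨n, x, rfl⟩ _ ⟨k, y, rfl⟩
    exact ⟨n + k, Fin.append x y, by simp [Fin.sum_univ_add]⟩
  have hA_zero : (0 : EllInfty S) ∈ A := ⟨0, Fin.elim0, by simp⟩
  have hA_convex : Convex ℝ A := fun ψ hψ χ hχ t t' ht ht' _ =>
    hA_add _ (hA_smul t ht ψ hψ) _ (hA_smul t' ht' χ hχ)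
  let U : Set (EllInfty S) := {φ | ∃ δ > 0, ∀ s, φ s ≤ -δ}
  have hU_open : IsOpen U := by
    refine Metric.isOpen_iff.2 ?_
    rintro φ ⟨δ, hδ, hφ⟩
    refine ⟨δ / 2, half_pos hδ, fun ψ hψ => ⟨δ / 2, half_pos hδ, fun s => ?_⟩⟩
    rw [mem_ball_iff_norm] at hψ
    have h1 := (le_abs_self _).trans ((ψ - φ).abs_apply_le s)
    rw [lp.coeFn_sub, Pi.sub_apply] at h1
    linarith [hφ s]
  have hU_convex : Convex ℝ U := by
    rintro φ ⟨δ, hδ, hφ⟩ ψ ⟨δ', hδ', hψ⟩ t t' ht ht' htt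
    refine ⟨min δ δ', lt_min hδ hδ', fun s => ?_⟩
    have h1 : t * φ s ≤ t * -min δ δ' :=
      mul_le_mul_of_nonneg_left ((hφ s).trans (neg_le_neg (min_le_left _ _))) ht
    have h2 : t' * ψ s ≤ t' * -min δ δ' :=
      mul_le_mul_of_nonneg_left ((hψ s).trans (neg_le_neg (min_le_right _ _))) ht'
    calc t * φ s + t' * ψ s ≤ t * -min δ δ' + t' * -min δ δ' := add_le_add h1 h2
      _ = -min δ δ' := by rw [← add_mul, htt, one_mul]
  have hdisj : Disjoint U A := by
    rw [Set.disjoint_left]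
    rintro _ ⟨δ, hδ, hle⟩ ⟨n, x, rfl⟩
    have h1 : ∀ s, ∑ i, J (x i) s ^ 2 ≤ (∑ i, q (x i) - δ) / C := by
      intro s
      have h2 := hle s
      rw [lp.coeFn_sum, Finset.sum_apply] at h2
      simp only [ha_apply, Finset.sum_sub_distrib, ← Finset.mul_sum] at h2
      rw [le_div_iff₀ hC]
      linarith
    obtain ⟨s⟩ := ‹Nonempty S›
    have h3 := hbound n x _ ((Finset.sum_nonneg fun _ _ => sq_nonneg _).trans (h1 s)) h1
    rw [mul_div_cancel₀ _ hC.ne'] at h3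
    linarith
  obtain ⟨f, u, hfU, hfA⟩ := geometric_hahn_banach_open hU_convex hU_open hA_convex hdisj
  have hu : u ≤ 0 := by simpa using hfA 0 hA_zero
  have hf1 : 0 < f 1 := by
    have h1 := hfU (-1) ⟨1, one_pos, fun _ => le_refl (-1 : ℝ)⟩
    rw [map_neg] at h1
    linarith
  have hfA0 : ∀ ψ ∈ A, 0 ≤ f ψ := by
    intro ψ hψ
    by_contra! hneg
    have h1 := hfA _ (hA_smul (u / f ψ + 1)
      (add_nonneg (div_nonneg_of_nonpos hu hneg.le) zero_le_one) ψ hψ)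
    rw [map_smul, smul_eq_mul, add_mul, div_mul_cancel₀ _ hneg.ne] at h1
    linarith
  -- Nonnegativity of `f` on `a x` reads `q x * f 1 ≤ C * f (J x * J x)`, which dictates the factor.
  refine ⟨(C / f 1) • f, fun φ hφ => ?_, fun x => ?_⟩
  · refine mul_nonneg (by positivity) ?_
    by_contra! hneg
    have hδ : 0 < -f φ / f 1 := div_pos (neg_pos.2 hneg) hf1
    have h1 := hfU (-φ - (-f φ / f 1) • 1) ⟨_, hδ, fun s => by
      have := hφ s
      simp only [lp.coeFn_sub, lp.coeFn_neg, lp.coeFn_smul, Pi.sub_apply, Pi.neg_apply,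
        Pi.smul_apply, lp.infty_coeFn_one, Pi.one_apply, smul_eq_mul, mul_one]
      linarith⟩
    rw [map_sub, map_neg, map_smul, smul_eq_mul, div_mul_cancel₀ _ hf1.ne'] at h1
    linarith
  · have h1 := hfA0 (a x) ⟨1, fun _ => x, by simp⟩
    simp only [a, map_sub, map_smul, smul_eq_mul] at h1
    change q x ≤ C / f 1 * f (J x * J x)
    rw [div_mul_eq_mul_div, le_div_iff₀ hf1]
    linarith

end PietschDomination

/-! ### Evaluation maps into $\ell_\infty$ and the extension of forms. -/

section Evaluation

/-- A family of functionals in the unit ball of the dual defines an operator into `ℓ∞`. -/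
noncomputable def evalEllInfty {Y S : Type*} [NormedAddCommGroup Y] [NormedSpace ℝ Y]
    (η : S → StrongDual ℝ Y) (hη : ∀ s, ‖η s‖ ≤ 1) : Y →L[ℝ] EllInfty S :=
  LinearMap.mkContinuous
    { toFun := fun y => EllInfty.mk (fun s => η s y) ‖y‖ fun s =>
        ((η s).le_opNorm y).trans (mul_le_of_le_one_left (norm_nonneg _) (hη s))
      map_add' := fun x y => by ext s; exact map_add (η s) x y
      map_smul' := fun t y => by ext s; exact map_smul (η s) t y }
    1 fun y => by
      rw [one_mul]
      exact EllInfty.norm_le (norm_nonneg y) fun s =>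
        ((η s).le_opNorm y).trans (mul_le_of_le_one_left (norm_nonneg _) (hη s))

variable {X : Type u} [NormedAddCommGroup X] [NormedSpace ℝ X]

/-- A functional on a subspace extends to the whole space without increasing its norm. -/
lemma LinearIsometry.exists_dual_extension {Y : Type*} [NormedAddCommGroup Y] [NormedSpace ℝ Y]
    (j : X →ₗᵢ[ℝ] Y) (ξ : StrongDual ℝ X) :
    ∃ η : StrongDual ℝ Y, ‖η‖ ≤ ‖ξ‖ ∧ ∀ x, η (j x) = ξ x := by
  let e := j.equivRange
  obtain ⟨η, hη, hnorm⟩ := exists_extension_norm_eq (LinearMap.range j.toLinearMap)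
    (ξ.comp (e.symm.toLinearIsometry.toContinuousLinearMap))
  refine ⟨η, ?_, fun x => ?_⟩
  · rw [hnorm]
    refine ContinuousLinearMap.opNorm_le_bound _ (norm_nonneg _) fun y => ?_
    refine (ξ.le_opNorm _).trans_eq ?_
    congr 1
    exact e.symm.norm_map y
  · refine (hη (e x)).trans ?_
    simp

lemma isContinuousQuadraticForm_comp_mul_self {S : Type*} (m : EllInfty S →L[ℝ] ℝ)
    (J : X →L[ℝ] EllInfty S) : IsContinuousQuadraticForm fun x => m (J x * J x) :=
  ⟨((ContinuousLinearMap.compL ℝ _ _ ℝ m).comp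
    (ContinuousLinearMap.mul ℝ (EllInfty S))).bilinearComp J J, fun x => by simp⟩

lemma IsContinuousQuadraticForm.map_smul {q : X → ℝ} (hq : IsContinuousQuadraticForm q) (t : ℝ)
    (x : X) : q (t • x) = t ^ 2 * q x := by
  obtain ⟨b, hb⟩ := hq
  simp [hb]
  ring

/-- On a Hilbert–Schmidt space nonnegative quadratic forms extend to all larger spaces. -/
theorem IsHilbertSchmidtSpace.exists_extension (hX : IsHilbertSchmidtSpace X) {q : X → ℝ}
    (hq : IsContinuousQuadraticForm q) (hpos : ∀ x, 0 ≤ q x) {Y : Type*} [NormedAddCommGroup Y]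
    [NormedSpace ℝ Y] (j : X →ₗᵢ[ℝ] Y) :
    ∃ Q : Y → ℝ, IsContinuousQuadraticForm Q ∧ ∀ x, Q (j x) = q x := by
  obtain ⟨H, _, _, _, T, hT⟩ := hq.exists_hilbert hpos
  obtain ⟨C, hC0, hC⟩ := hX.exists_weakSquareBound T
  let S := Metric.closedBall (0 : StrongDual ℝ X) 1
  have hS : ∀ s : S, ‖(s : StrongDual ℝ X)‖ ≤ 1 := fun s => mem_closedBall_zero_iff.1 s.2
  have : Nonempty S := ⟨⟨0, Metric.mem_closedBall_self zero_le_one⟩⟩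
  choose η hη hηj using fun s : S => j.exists_dual_extension s
  have hη1 : ∀ s, ‖η s‖ ≤ 1 := fun s => (hη s).trans (hS s)
  -- `C + 1` replaces `C` because a strictly positive constant is required.
  obtain ⟨m, hm0, hm⟩ := exists_mean_of_weakSquareBound
    (evalEllInfty (fun s : S => (s : StrongDual ℝ X)) hS).toLinearMap hq.map_smul
    (C := C + 1) (by linarith) fun n x M hM hx => by
      have h1 : ∑ i, q (x i) ≤ C * M := by
        simpa only [hT] using hC n x M hM fun ξ hξ => hx ⟨ξ, mem_closedBall_zero_iff.2 hξ⟩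
      linarith
  refine hq.exists_extension_of_le hpos
    (isContinuousQuadraticForm_comp_mul_self m (evalEllInfty η hη1))
    (fun y => hm0 _ fun s => ?_) j.toContinuousLinearMap fun x => ?_
  · rw [lp.infty_coeFn_mul]
    exact mul_self_nonneg _
  · have h1 : evalEllInfty η hη1 (j x) = evalEllInfty (fun s : S => (s : StrongDual ℝ X)) hS x := by
      ext s
      exact hηj s x
    exact (hm x).trans_eq (by simp [h1])

variable (X) in
/-- The canonical isometric embedding of a normed space into the bounded functions on the unit ball
of its dual. -/
noncomputable def dualBallEmbedding :
    X →ₗᵢ[ℝ] EllInfty (ULift.{v} (Metric.closedBall (0 : StrongDual ℝ X) 1)) where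
  toLinearMap := (evalEllInfty
    (fun s : ULift.{v} (Metric.closedBall (0 : StrongDual ℝ X) 1) => (s.down : StrongDual ℝ X))
    fun s => mem_closedBall_zero_iff.1 s.down.2).toLinearMap
  norm_map' x := by
    refine le_antisymm (EllInfty.norm_le (norm_nonneg x) fun s => ?_) ?_
    · exact (s.down.1.le_opNorm x).trans
        (mul_le_of_le_one_left (norm_nonneg _) (mem_closedBall_zero_iff.1 s.down.2))
    · obtain ⟨ξ, hξ, hx⟩ := exists_dual_vector'' ℝ x
      have h1 : ξ x = ‖x‖ := hx
      let s₀ : ULift.{v} (Metric.closedBall (0 : StrongDual ℝ X) 1) :=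
        ⟨⟨ξ, mem_closedBall_zero_iff.2 hξ⟩⟩
      rw [← h1]
      exact (le_abs_self (ξ x)).trans (EllInfty.abs_apply_le
        (evalEllInfty (fun s : ULift.{v} (Metric.closedBall (0 : StrongDual ℝ X) 1) =>
          (s.down : StrongDual ℝ X)) (fun s => mem_closedBall_zero_iff.1 s.down.2) x) s₀)

end Evaluation

/-- A real Banach space `X` is a Hilbert–Schmidt space if and only if every nonnegative continuous
quadratic form on `X` extends to a continuous quadratic form on every Banach space `Y` containing
`X` (through a linear isometric embedding `j`). -/
theorem proposition3p3 (X : Type u) [NormedAddCommGroup X] [NormedSpace ℝ X]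
    [CompleteSpace X] :
    IsHilbertSchmidtSpace X ↔
      ∀ q : X → ℝ, IsContinuousQuadraticForm q → (∀ x, 0 ≤ q x) →
        ∀ (Y : Type (max u v)) [NormedAddCommGroup Y] [NormedSpace ℝ Y] [CompleteSpace Y]
          (j : X →ₗᵢ[ℝ] Y),
          ∃ Q : Y → ℝ, IsContinuousQuadraticForm Q ∧ ∀ x, Q (j x) = q x := by
  refine ⟨fun hX q hq hpos Y _ _ _ j => hX.exists_extension hq hpos j, fun h T => ?_⟩
  -- The `ULift` in the index set serves only to put $\ell_\infty$ in the universe over which `Y`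
  -- ranges.
  obtain ⟨Q, ⟨b, hb⟩, hQ⟩ := h _ (isContinuousQuadraticForm_norm_sq T) (fun x => by positivity) _
    (dualBallEmbedding.{u, v} X)
  refine (isPSumming_two_iff T).2 ⟨128 * ‖b‖, by positivity, fun n x M hM hx => ?_⟩
  have h1 := sum_bilin_le_of_sum_sq_le b (fun i => dualBallEmbedding.{u, v} X (x i)) hM
    fun s => hx s.down (mem_closedBall_zero_iff.1 s.down.2)
  simpa only [← hb, hQ] using h1
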